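/- Let $n\ge 1$ and let $R_n=\{0,\dots,n-1\}$ be the dihedral quandle, $i*j\equiv 2j-i \pmod n$. Let $\phi$ be an integral positive quandle 2-cocycle of $R_n$, i.e. a function $\phi:R_n\times R_n\to\mathbb Z$ with $\phi(a,a)=0$ and $$-2\phi(b,c)+\phi(a,c)+\phi(a*b,c)-\phi(a,b)-\phi(a*c,b*c)=0\qquad\text{for all } a,b,c\in R_n .$$ Let $K$ be an oriented diagram in the plane of a knot (one component). A proper coloring $\rho$ of $K$ assigns an element of $R_n$ to each arc such that, at each crossing, if the over-arc has color $b$ and the under-arc on the right of the over-arc has color $a$, then the under-arc on the left of the over-arc has color $a*b$; let $\mathrm{Col}_{R_n}(K)$ be the number of proper colorings. Color the regions of the plane cut out by $K$ black and white in checkerboard fashion with the unbounded region white, and let the sign $\epsilon(\tau)$ of a crossing $\tau$ be $+1$ if the two opposite regions at $\tau$ swept out when the upper strand is rotated counterclockwise to the lower strand are black, and $-1$ if they are white. Writing the group ring $\mathbb Z[\mathbb Z]$ as $\mathbb Z[t^{\pm1}]$, define the positive quandle 2-cocycle invariant $$\Phi_\phi(K)=\sum_{\rho}\ \prod_{\tau}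 t^{\,\epsilon(\tau)\,\phi(a_\tau,b_\tau)}\in\mathbb Z[t^{\pm1}],$$ where $\rho$ runs over all proper colorings, $\tau$ over all crossings, and $b_\tau$, $a_\tau$ are the colors under $\rho$ of the over-arc at $\tau$ and of the under-arc on its right. Then $\Phi_\phi(K)$ is trivial: $$\Phi_\phi(K)=\mathrm{Col}_{R_n}(K)\cdot 1 .$$ -/

import Mathlib

/-! ### Positive quandle 2-cocycles

Mathlib writes quandles with a left action: `b ◃ a` is the element `a ∗ b` of the convention
`(a ∗ b) ∗ c = (a ∗ c) ∗ (b ∗ c)`.  In particular `Quandle.Dihedral n` is `ZMod n` with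
`j ◃ i = 2 j - i`, i.e. `i ∗ j = 2 j - i`. -/

/-- A positive quandle 2-cocycle of `X` with coefficients in the abelian group `G`: a homomorphism
from the free abelian group on pairs of elements of `X` (given by its values on the pairs) which
vanishes on the degenerate pairs `(a, a)` and on the boundaries
`∂⁺(a, b, c) = -2 (b, c) + (a, c) + (a ∗ b, c) - (a, b) - (a ∗ c, b ∗ c)`. -/
structure IsPositiveQuandleTwoCocycle {X G : Type*} [Quandle X] [AddCommGroup G]
    (φ : X → X → G) : Prop where
  degenerate : ∀ a : X, φ a a = 0
  cocycle : ∀ a b c : X,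
    -φ b c - φ b c + φ a c + φ (Shelf.act b a) c - φ a b
      - φ (Shelf.act c a) (Shelf.act c b) = 0

/-! ### Oriented knot diagrams

An oriented knot diagram is recorded combinatorially, by the signed Gauss diagram of a generic
immersion of one oriented circle, together with the requirement that the underlying 4-valent graph
is embedded in the sphere (Euler characteristic two), and a choice of the region which is unbounded
in the plane. -/

/-- The signed Gauss diagram of an oriented closed curve with over/under crossings.
Travelling once around the circle one meets the points `0, 1, …, numPoints - 1` in this cyclic
order.  Each crossing is met twice: once at the point `overPoint x` and once at the point
`underPoint x`.
All these points are different; the points that belong to no crossing are ordinary points of the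
curve (subdivision points; they are allowed so that the circle without crossings is included).
The edge number `k` of the curve runs from the point `k - 1` to the point `k`. -/
structure SignedGaussDiagram where
  /-- number of marked points on the circle -/
  numPoints : ℕ
  numPoints_neZero : NeZero numPoints
  /-- number of crossings -/
  numCrossings : ℕ
  /-- the point at which the crossing is traversed on the upper strand -/
  overPoint : Fin numCrossings → ZMod numPoints
  /-- the point at which the crossing is traversed on the lower strand -/
  underPoint : Fin numCrossings → ZMod numPoints
  passages_injective : Function.Injective (Sum.elim overPoint underPoint)
  /-- whether the crossing is positive (has writhe `+1`), which means that the lower strand crosses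
  the upper strand from its right hand side to its left hand side -/
  positive : Fin numCrossings → Bool

namespace SignedGaussDiagram

attribute [instance] numPoints_neZero

variable (D : SignedGaussDiagram)

/-- The crossings. -/
abbrev Crossing : Type := Fin D.numCrossings

/-- The edges of the underlying graph of the diagram. -/
abbrev Edge : Type := ZMod D.numPoints

/-- The two sides of an oriented edge. -/
inductive Hand : Type
  | left
  | right

instance : Finite Hand :=
  Finite.of_injective (fun h : Hand => (Hand.rec true false h : Bool)) (by
    intro a b h; cases a <;> cases b <;> simp_all)

open Hand

/-- `D.Corner s t`: the sides `s` and `t` of two edges bound the same region near a common point.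
At an ordinary point these are the two left and the two right sides of the adjacent edges; at a
crossing, these are the two sides in each of the four quadrants.  The upper strand enters a crossing
`x` through the edge `overPoint x` and leaves it through `overPoint x + 1`, and similarly for the lower
strand. -/
inductive Corner : D.Edge × Hand → D.Edge × Hand → Prop
  | ordinary (k : D.Edge) (h : Hand) (ho : k ∉ Set.range D.overPoint) (hu : k ∉ Set.range D.underPoint) :
      Corner (k, h) (k + 1, h)
  | posFrontLeft (x : D.Crossing) (hx : D.positive x = true) :
      Corner (D.overPoint x + 1, left) (D.underPoint x + 1, right)
  | posBackLeft (x : D.Crossing) (hx : D.positive x = true) :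
      Corner (D.overPoint x, left) (D.underPoint x + 1, left)
  | posBackRight (x : D.Crossing) (hx : D.positive x = true) :
      Corner (D.overPoint x, right) (D.underPoint x, left)
  | posFrontRight (x : D.Crossing) (hx : D.positive x = true) :
      Corner (D.overPoint x + 1, right) (D.underPoint x, right)
  | negFrontLeft (x : D.Crossing) (hx : D.positive x = false) :
      Corner (D.overPoint x + 1, left) (D.underPoint x, left)
  | negBackLeft (x : D.Crossing) (hx : D.positive x = false) :
      Corner (D.overPoint x, left) (D.underPoint x, right)
  | negBackRight (x : D.Crossing) (hx : D.positive x = false) :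
      Corner (D.overPoint x, right) (D.underPoint x + 1, right)
  | negFrontRight (x : D.Crossing) (hx : D.positive x = false) :
      Corner (D.overPoint x + 1, right) (D.underPoint x + 1, left)

/-- The regions of the complement of the curve, as classes of sides of edges: the boundary of a
region is traced by passing from an edge side to the next one at each corner. -/
def Region : Type := Quot D.Corner

/-- The region on a given side of an edge. -/
def region (e : D.Edge) (h : Hand) : D.Region := Quot.mk _ (e, h)

/-- The underlying connected graph has `numPoints - numCrossings` vertices and `numPoints` edges;
so it lies on the sphere, i.e. (vertices) - (edges) + (regions) = 2, iff the number of regions is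
the number of crossings plus two. -/
def IsPlanar : Prop := Nat.card D.Region = D.numCrossings + 2

/-- The arcs of the diagram: consecutive edges belong to the same arc unless the point
between them is an undercrossing. -/
def Arc : Type := Quot fun e f : D.Edge => f = e + 1 ∧ e ∉ Set.range D.underPoint

/-- The arc that contains a given edge. -/
def arc (e : D.Edge) : D.Arc := Quot.mk _ e

instance : Finite D.Region := inferInstanceAs (Finite (Quot D.Corner))

instance : Finite D.Arc :=
  inferInstanceAs (Finite (Quot fun e f : D.Edge => f = e + 1 ∧ e ∉ Set.range D.underPoint))

/-- The arc of the upper strand at a crossing. -/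
def overArc (x : D.Crossing) : D.Arc := D.arc (D.overPoint x)

/-- The under-arc at a crossing on the right hand side of the (oriented) upper strand. -/
def rightUnderArc (x : D.Crossing) : D.Arc :=
  if D.positive x then D.arc (D.underPoint x) else D.arc (D.underPoint x + 1)

/-- The under-arc at a crossing on the left hand side of the (oriented) upper strand. -/
def leftUnderArc (x : D.Crossing) : D.Arc :=
  if D.positive x then D.arc (D.underPoint x + 1) else D.arc (D.underPoint x)

/-- Proper colorings of the diagram by a quandle: at each crossing, if `b` is the color of the
over-arc, and `a` the color of the under-arc on its right, then the under-arc on its left has the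
color `a ∗ b`. -/
def ProperColoring (X : Type*) [Quandle X] : Type _ :=
  {ρ : D.Arc → X // ∀ x : D.Crossing,
    ρ (D.leftUnderArc x) = Shelf.act (ρ (D.overArc x)) (ρ (D.rightUnderArc x))}

instance (X : Type*) [Quandle X] [Finite X] : Finite (D.ProperColoring X) :=
  inferInstanceAs (Finite {ρ : D.Arc → X // ∀ x : D.Crossing,
    ρ (D.leftUnderArc x) = Shelf.act (ρ (D.overArc x)) (ρ (D.rightUnderArc x))})

noncomputable instance (X : Type*) [Quandle X] [Finite X] : Fintype (D.ProperColoring X) :=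
  Fintype.ofFinite _

/-- The quandle coloring invariant `Col_X`. -/
noncomputable def col (X : Type*) [Quandle X] : ℕ := Nat.card (D.ProperColoring X)

end SignedGaussDiagram

/-- An oriented knot diagram in the plane: a planar signed Gauss diagram, together with the choice
of the region that is unbounded. -/
structure OrientedKnotDiagram extends SignedGaussDiagram where
  planar : toSignedGaussDiagram.IsPlanar
  /-- the unbounded region -/
  unbounded : toSignedGaussDiagram.Region

/-- The two colors of a checkerboard. -/
inductive Shade : Type
  | white
  | black

namespace OrientedKnotDiagram

open SignedGaussDiagram SignedGaussDiagram.Hand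

variable (D : OrientedKnotDiagram)

/-- A checkerboard coloring of the regions of the diagram: the two regions adjacent to an edge have
different colors, and the unbounded region is white. -/
def IsCheckerboard (κ : D.Region → Shade) : Prop :=
  (∀ e : D.Edge, κ (D.region e left) ≠ κ (D.region e right)) ∧ κ D.unbounded = Shade.white

/-- A function on regions which does not change across any edge is constant. -/
theorem eq_of_forall_left_eq_right {A : Type*} (c : D.Region → A)
    (h : ∀ e : D.Edge, c (D.region e left) = c (D.region e right)) (r s : D.Region) :
    c r = c s := by
  have q : ∀ {a b : D.Edge × Hand}, D.Corner a b →
      c (D.region a.1 a.2) = c (D.region b.1 b.2) := fun hab => congrArg c (Quot.sound hab)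
  have step : ∀ e : D.Edge, c (D.region (e + 1) left) = c (D.region e left) := by
    intro e
    by_cases ho : e ∈ Set.range D.overPoint
    · obtain ⟨x, rfl⟩ := ho
      cases hx : D.positive x with
      | true =>
        exact (q (.posFrontLeft x hx)).trans ((h _).symm.trans (q (.posBackLeft x hx)).symm)
      | false =>
        exact (q (.negFrontLeft x hx)).trans ((h _).trans (q (.negBackLeft x hx)).symm)
    · by_cases hu : e ∈ Set.range D.underPoint
      · obtain ⟨x, rfl⟩ := hu
        cases hx : D.positive x with
        | true =>
          exact (q (.posBackLeft x hx)).symm.trans ((h _).trans (q (.posBackRight x hx)))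
        | false =>
          exact (q (.negFrontRight x hx)).symm.trans ((h _).symm.trans (q (.negFrontLeft x hx)))
      · exact (q (.ordinary e left ho hu)).symm
  have nat : ∀ k : ℕ, c (D.region (k : ZMod D.numPoints) left) = c (D.region 0 left) := by
    intro k
    induction k with
    | zero => simp
    | succ k ih => rw [Nat.cast_succ, step, ih]
  have all : ∀ r : D.Region, c r = c (D.region 0 left) := by
    rintro ⟨e, hd⟩
    have he : c (D.region e left) = c (D.region 0 left) := by
      simpa using nat (ZMod.val (n := D.numPoints) e)
    cases hd
    · exact he
    · exact (h e).symm.trans he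
  rw [all r, all s]

/-- On a planar diagram there is a function from the regions to the integers modulo two which
changes across each edge. -/
theorem exists_zmod_two_coloring :
    ∃ c : D.Region → ZMod 2,
      ∀ e : D.Edge, c (D.region e left) + c (D.region e right) = 1 := by
  classical
  have : Fintype D.Region := Fintype.ofFinite _
  let δ : (D.Region → ZMod 2) →ₗ[ZMod 2] (D.Edge → ZMod 2) :=
    { toFun := fun c e => c (D.region e left) + c (D.region e right)
      map_add' := fun c d => by ext e; simp only [Pi.add_apply]; ring
      map_smul' := fun a c => by ext e; simp only [Pi.smul_apply, smul_eq_mul, RingHom.id_apply]; ring }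
  let K : Submodule (ZMod 2) (D.Edge → ZMod 2) :=
    { carrier := {w | (∀ k : D.Edge, k ∉ Set.range D.overPoint → k ∉ Set.range D.underPoint →
          w (k + 1) = w k) ∧ ∀ x : D.Crossing, w (D.overPoint x) + w (D.overPoint x + 1) =
            w (D.underPoint x) + w (D.underPoint x + 1)}
      zero_mem' := ⟨fun _ _ _ => rfl, fun _ => rfl⟩
      add_mem' := by
        rintro v w ⟨hv, hv'⟩ ⟨hw, hw'⟩
        refine ⟨fun k h1 h2 => by simp only [Pi.add_apply, hv k h1 h2, hw k h1 h2], fun x => ?_⟩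
        simp only [Pi.add_apply]
        linear_combination hv' x + hw' x
      smul_mem' := by
        rintro a w ⟨hw, hw'⟩
        refine ⟨fun k h1 h2 => by simp only [Pi.smul_apply, hw k h1 h2], fun x => ?_⟩
        simp only [Pi.smul_apply, smul_eq_mul]
        linear_combination a * hw' x }
  have hle : LinearMap.range δ ≤ K := by
    rintro _ ⟨c, rfl⟩
    have q : ∀ {a b : D.Edge × Hand}, D.Corner a b →
        c (D.region a.1 a.2) = c (D.region b.1 b.2) := fun hab => congrArg c (Quot.sound hab)
    refine ⟨fun k ho hu => ?_, fun x => ?_⟩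
    · exact (congrArg₂ (· + ·) (q (.ordinary k left ho hu)) (q (.ordinary k right ho hu))).symm
    · change c _ + c _ + (c _ + c _) = c _ + c _ + (c _ + c _)
      cases hx : D.positive x with
      | true =>
        linear_combination q (.posFrontLeft x hx) + q (.posBackLeft x hx)
          + q (.posBackRight x hx) + q (.posFrontRight x hx)
      | false =>
        linear_combination q (.negFrontLeft x hx) + q (.negBackLeft x hx)
          + q (.negBackRight x hx) + q (.negFrontRight x hx)
  have hK : Module.finrank (ZMod 2) K ≤ 1 + D.numCrossings := by
    let f : K →ₗ[ZMod 2] (ZMod 2 × (D.Crossing → ZMod 2)) :=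
      { toFun := fun w => (w.1 0, fun x => w.1 (D.overPoint x) + w.1 (D.overPoint x + 1))
        map_add' := fun v w => by
          ext
          · rfl
          · simp only [Submodule.coe_add, Pi.add_apply, Prod.snd_add]; ring
        map_smul' := fun a w => by
          ext
          · rfl
          · simp only [Submodule.coe_smul, Pi.smul_apply, smul_eq_mul, RingHom.id_apply,
              Prod.smul_snd]
            ring }
    have hf : Function.Injective f := by
      rw [injective_iff_map_eq_zero]
      rintro ⟨w, hw, hw'⟩ h0
      have h1 : w 0 = 0 := congrArg Prod.fst h0
      have h2 : ∀ x, w (D.overPoint x) + w (D.overPoint x + 1) = 0 := fun x =>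
        congrFun (congrArg Prod.snd h0) x
      have two : ∀ a b : ZMod 2, a + b = 0 → b = a := by decide
      have step : ∀ e : D.Edge, w (e + 1) = w e := by
        intro e
        by_cases ho : e ∈ Set.range D.overPoint
        · obtain ⟨x, rfl⟩ := ho
          exact two _ _ (h2 x)
        · by_cases hu : e ∈ Set.range D.underPoint
          · obtain ⟨x, rfl⟩ := hu
            exact two _ _ ((hw' x).symm.trans (h2 x))
          · exact hw e ho hu
      have nat : ∀ k : ℕ, w (k : ZMod D.numPoints) = 0 := by
        intro k
        induction k with
        | zero => simpa using h1
        | succ k ih => rw [Nat.cast_succ, step, ih]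
      apply Subtype.ext
      funext e
      simpa using nat (ZMod.val (n := D.numPoints) e)
    simpa using LinearMap.finrank_le_finrank_of_injective hf
  have hker : Module.finrank (ZMod 2) (LinearMap.ker δ) ≤ 1 := by
    let g : LinearMap.ker δ →ₗ[ZMod 2] ZMod 2 :=
      (LinearMap.proj D.unbounded).comp (LinearMap.ker δ).subtype
    have hg : Function.Injective g := by
      rw [injective_iff_map_eq_zero]
      rintro ⟨c, hc⟩ h0
      have two : ∀ a b : ZMod 2, a + b = 0 → a = b := by decide
      have h := D.eq_of_forall_left_eq_right c fun e => two _ _ (congrFun hc e)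
      apply Subtype.ext
      funext r
      exact (h r D.unbounded).trans h0
    simpa using LinearMap.finrank_le_finrank_of_injective hg
  have hrank := LinearMap.finrank_range_add_finrank_ker δ
  have hcard : Module.finrank (ZMod 2) (D.Region → ZMod 2) = D.numCrossings + 2 := by
    rw [Module.finrank_fintype_fun_eq_card, ← Nat.card_eq_fintype_card]
    exact D.planar
  have heq : LinearMap.range δ = K := Submodule.eq_of_le_of_finrank_le hle (by omega)
  have hone : (fun _ => 1 : D.Edge → ZMod 2) ∈ K := ⟨fun _ _ _ => rfl, fun _ => rfl⟩
  rw [← heq] at hone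
  obtain ⟨c, hc⟩ := hone
  exact ⟨c, fun e => congrFun hc e⟩

/-- Every diagram has exactly one checkerboard coloring. -/
theorem existsUnique_isCheckerboard : ∃! κ : D.Region → Shade, D.IsCheckerboard κ := by
  classical
  obtain ⟨c, hc⟩ := D.exists_zmod_two_coloring
  refine ⟨fun r => if c r = c D.unbounded then Shade.white else Shade.black, ⟨?_, if_pos rfl⟩, ?_⟩
  · intro e
    have key : ∀ a b u : ZMod 2, a + b = 1 →
        (if a = u then Shade.white else Shade.black) ≠
          (if b = u then Shade.white else Shade.black) := by
      have : ∀ a b u : ZMod 2, a + b = 1 → (a = u ∧ b ≠ u) ∨ (a ≠ u ∧ b = u) := by decide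
      intro a b u h
      rcases this a b u h with ⟨h1, h2⟩ | ⟨h1, h2⟩ <;> simp [h1, h2]
    exact key _ _ _ (hc e)
  · intro κ hκ
    have h := D.eq_of_forall_left_eq_right
      (fun r => (κ r = Shade.white ↔ c r = c D.unbounded)) (fun e => by
        have two : ∀ a b u : ZMod 2, a + b = 1 → (a = u ↔ ¬ b = u) := by decide
        have h1 := two _ _ (c D.unbounded) (hc e)
        have h2 := hκ.1 e
        have h3 : κ (D.region e left) = Shade.white ↔ ¬ κ (D.region e right) = Shade.white := by
          cases h4 : κ (D.region e left) <;> cases h5 : κ (D.region e right) <;> simp_all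
        exact propext (by rw [h1, h3, not_iff_not]))
    funext r
    have hr : (κ r = Shade.white ↔ c r = c D.unbounded) :=
      (h r D.unbounded).symm ▸ (by simp [hκ.2])
    by_cases h6 : c r = c D.unbounded
    · simpa [h6] using hr
    · cases h7 : κ r <;> simp_all

/-- The checkerboard coloring of the diagram. -/
noncomputable def checkerboard : D.Region → Shade := D.existsUnique_isCheckerboard.choose

theorem checkerboard_spec : D.IsCheckerboard D.checkerboard :=
  D.existsUnique_isCheckerboard.choose_spec.1

open Classical in
/-- The sign of a crossing with respect to the checkerboard coloring.  When the upper strand is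
rotated counterclockwise about the crossing until it meets the lower strand, it sweeps out two
opposite quadrants, one of which is in front and to the left; the sign is `+1` if these are black,
and `-1` if they are white.  (It does not depend on the orientation.) -/
noncomputable def sign (x : D.Crossing) : ℤ :=
  if D.checkerboard (D.region (D.overPoint x + 1) left) = Shade.black then 1 else -1

/-- The weight of a crossing for a 2-cocycle `φ` and a proper coloring: `ε φ(a, b)`, where `ε` is
the sign of the crossing, `b` the color of the over-arc, and `a`, `a ∗ b` the colors of the
under-arcs (the group `G` is written additively). -/
noncomputable def weight {X G : Type*} [Quandle X] [AddCommGroup G] (φ : X → X → G)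
    (ρ : D.ProperColoring X) (x : D.Crossing) : G :=
  D.sign x • φ (ρ.1 (D.rightUnderArc x)) (ρ.1 (D.overArc x))

/-- The positive quandle 2-cocycle invariant, an element of the group ring of `G` over the
integers: the sum over all proper colorings of the group elements obtained by composing the weights
of all crossings. -/
noncomputable def positiveCocycleInvariant {X G : Type*} [Quandle X] [Finite X] [AddCommGroup G]
    (φ : X → X → G) : AddMonoidAlgebra ℤ G :=
  ∑ ρ : D.ProperColoring X, AddMonoidAlgebra.single (∑ x : D.Crossing, D.weight φ ρ x) 1

end OrientedKnotDiagram

instance (n : ℕ) [NeZero n] : Finite (Quandle.Dihedral n) :=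
  inferInstanceAs (Finite (ZMod n))

/-! The weights of every single proper coloring add up to zero.  Three facts carry this.

* Coboundaries `(a, b) ↦ 2 f b - f a - f (a ∗ b)` have weight sum zero
  (`sum_sign_mul_coboundary_eq_zero`).  Give each edge the sign
  `±1` according to the shade on its left.  This sign flips at every crossing point, so for a
  function `f` of the colors the increments of `edgeSign * f` along the knot, whose total is zero,
  vanish at ordinary points and are `ε (f b + f b)` at the upper and `-ε (f a + f (a ∗ b))` at the
  lower passage through a crossing of sign `ε` with colors `a`, `b`.
* Let `H` be a finite subquandle in which every map `b ↦ a ∗ b` is injective.  Summing the cocycle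
  condition over `b` in `H` shows that on `H` the multiple `#H • φ` is the coboundary of
  `a ↦ -∑ b ∈ H, φ a b` (`IsPositiveQuandleTwoCocycle.card_nsmul_eq`).
* The colors `a` and `2 b - a` that meet at an undercrossing differ by `2 (b - a)`.  As the knot has
  one component, all differences of colors are therefore divisible by `2`, hence by `4`, and so on
  (`two_pow_dvd_color_sub`).  If `n = 2 ^ k * m` with `m` odd, the colors lie in a coset of
  `2 ^ k ℤ / n ℤ`, which has odd order, and this coset is a subquandle `H` of the required kind
  (`cosetTwoPow`).

Since `ℤ` has no torsion, the weight sum is zero because its `#H`-fold multiple is. -/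

/-! ### Positive cocycles on finite subquandles -/

/-- On a finite subquandle `H` in which all the maps `b ↦ a ∗ b` are injective, the multiple
`#H • φ` of a positive cocycle is a coboundary. -/
theorem IsPositiveQuandleTwoCocycle.card_nsmul_eq {X G : Type*} [Quandle X] [AddCommGroup G]
    {φ : X → X → G} (hφ : IsPositiveQuandleTwoCocycle φ) (H : Finset X)
    (hact : ∀ a ∈ H, ∀ b ∈ H, Shelf.act b a ∈ H)
    (hinj : ∀ a ∈ H, Set.InjOn (fun b => Shelf.act b a) (H : Set X))
    {a c : X} (ha : a ∈ H) (hc : c ∈ H) :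
    H.card • φ a c = ∑ b ∈ H, φ a b + ∑ b ∈ H, φ (Shelf.act c a) b
      - 2 • ∑ b ∈ H, φ c b := by
  have reindex : ∀ g : X → X, (∀ b ∈ H, g b ∈ H) → Set.InjOn g (H : Set X) → ∀ F : X → G,
      ∑ b ∈ H, F (g b) = ∑ b ∈ H, F b := fun g hg hi F =>
    Finset.sum_nbij g hg hi (Finset.surjOn_of_injOn_of_card_le g hg hi le_rfl) fun _ _ => rfl
  have key : ∀ a ∈ H, H.card • φ a c = ∑ b ∈ H, φ a b + ∑ b ∈ H, φ (Shelf.act c a) b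
      + ∑ b ∈ H, φ b c := by
    intro a ha
    have hsum := Finset.sum_eq_zero fun b (_ : b ∈ H) => hφ.cocycle a b c
    simp only [Finset.sum_sub_distrib, Finset.sum_add_distrib, Finset.sum_neg_distrib,
      Finset.sum_const] at hsum
    rw [reindex (fun b => Shelf.act b a) (fun b hb => hact a ha b hb) (hinj a ha) fun b => φ b c,
      reindex (fun b => Shelf.act c b) (fun b hb => hact b hb c hc)
        (fun _ _ _ _ h => (Rack.left_cancel c).mp h) fun b => φ (Shelf.act c a) b] at hsum
    rw [← sub_eq_zero, ← hsum]
    abel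
  -- The diagonal case identifies the sum over the first variable.
  have hdiag := key c hc
  rw [hφ.degenerate, smul_zero, Quandle.fix] at hdiag
  rw [key a ha, ← sub_eq_zero, hdiag]
  abel

/-! ### Checkerboard signs of edges -/

/-- The sign of a shade: `+1` for black and `-1` for white. -/
def Shade.toInt : Shade → ℤ
  | .white => -1
  | .black => 1

theorem Shade.toInt_eq_neg {s t : Shade} (h : s ≠ t) : s.toInt = -t.toInt := by
  cases s <;> cases t <;> simp_all [Shade.toInt]

namespace SignedGaussDiagram

variable (D : SignedGaussDiagram)

theorem overPoint_notMem_range_underPoint (x : D.Crossing) :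
    D.overPoint x ∉ Set.range D.underPoint := by
  rintro ⟨y, hy⟩
  simpa using D.passages_injective (a₁ := Sum.inr y) (a₂ := Sum.inl x) hy

theorem arc_add_one {e : D.Edge} (he : e ∉ Set.range D.underPoint) : D.arc (e + 1) = D.arc e :=
  (Quot.sound ⟨rfl, he⟩).symm

/-- The sum over all points of a function which vanishes at the ordinary points. -/
theorem sum_points_eq_sum_crossings (F : ZMod D.numPoints → ℤ)
    (hF : ∀ k, k ∉ Set.range D.overPoint → k ∉ Set.range D.underPoint → F k = 0) :
    ∑ k, F k = ∑ x : D.Crossing, (F (D.overPoint x) + F (D.underPoint x)) := by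
  have h := Fintype.sum_of_injective _ D.passages_injective
    (fun s => F (Sum.elim D.overPoint D.underPoint s))
    F (fun k hk => hF k (fun ⟨x, hx⟩ => hk ⟨Sum.inl x, hx⟩) fun ⟨x, hx⟩ => hk ⟨Sum.inr x, hx⟩)
    fun _ => rfl
  rw [← h, Fintype.sum_sum_type, Finset.sum_add_distrib]
  rfl

end SignedGaussDiagram

namespace OrientedKnotDiagram

open SignedGaussDiagram SignedGaussDiagram.Hand

variable (D : OrientedKnotDiagram)

/-- The sign of an edge: `+1` if the region on its left is black, and `-1` if it is white. -/
noncomputable def edgeSign (e : D.Edge) : ℤ := (D.checkerboard (D.region e left)).toInt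

theorem toInt_right (e : D.Edge) :
    (D.checkerboard (D.region e right)).toInt = -D.edgeSign e :=
  Shade.toInt_eq_neg (D.checkerboard_spec.1 e).symm

theorem toInt_eq_of_corner {e f : D.Edge} {h h' : Hand} (hc : D.Corner (e, h) (f, h')) :
    (D.checkerboard (D.region e h)).toInt = (D.checkerboard (D.region f h')).toInt :=
  congrArg (fun r => (D.checkerboard r).toInt) (Quot.sound hc)

theorem edgeSign_add_one_of_ordinary {k : D.Edge} (ho : k ∉ Set.range D.overPoint)
    (hu : k ∉ Set.range D.underPoint) : D.edgeSign (k + 1) = D.edgeSign k :=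
  (D.toInt_eq_of_corner (.ordinary k left ho hu)).symm

theorem edgeSign_overPoint_add_one (x : D.Crossing) :
    D.edgeSign (D.overPoint x + 1) = D.sign x := by
  unfold edgeSign sign
  cases D.checkerboard (D.region (D.overPoint x + 1) left) <;> simp [Shade.toInt]

theorem edgeSign_underPoint_add_one (x : D.Crossing) :
    D.edgeSign (D.underPoint x + 1) = -D.sign x := by
  rw [← edgeSign_overPoint_add_one]
  cases hx : D.positive x with
  | true =>
    have h := D.toInt_eq_of_corner (.posFrontLeft x hx)
    rw [toInt_right] at h
    exact (neg_eq_iff_eq_neg.mpr h).symm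
  | false =>
    have h := D.toInt_eq_of_corner (.negFrontRight x hx)
    rw [toInt_right] at h
    exact h.symm

theorem edgeSign_overPoint (x : D.Crossing) : D.edgeSign (D.overPoint x) = -D.sign x := by
  rw [← edgeSign_underPoint_add_one]
  cases hx : D.positive x with
  | true => exact D.toInt_eq_of_corner (.posBackLeft x hx)
  | false =>
    have h := D.toInt_eq_of_corner (.negBackRight x hx)
    rw [toInt_right, toInt_right] at h
    exact neg_injective h

theorem edgeSign_underPoint (x : D.Crossing) : D.edgeSign (D.underPoint x) = D.sign x := by
  rw [← edgeSign_overPoint_add_one]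
  cases hx : D.positive x with
  | true =>
    have h := D.toInt_eq_of_corner (.posFrontRight x hx)
    rw [toInt_right, toInt_right] at h
    exact (neg_injective h).symm
  | false => exact (D.toInt_eq_of_corner (.negFrontLeft x hx)).symm

/-! ### The weight sum of a coboundary -/

theorem sum_sign_mul_arc_eq_zero (g : D.Arc → ℤ) :
    ∑ x : D.Crossing, D.sign x *
      (2 * g (D.overArc x) - g (D.rightUnderArc x) - g (D.leftUnderArc x)) = 0 := by
  have htel : ∑ k : D.Edge, (D.edgeSign (k + 1) * g (D.arc (k + 1))
      - D.edgeSign k * g (D.arc k)) = 0 := by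
    rw [Finset.sum_sub_distrib, sub_eq_zero]
    exact Equiv.sum_comp (Equiv.addRight (1 : D.Edge)) fun k => D.edgeSign k * g (D.arc k)
  rw [D.sum_points_eq_sum_crossings _ fun k ho hu => by
    rw [D.edgeSign_add_one_of_ordinary ho hu, D.arc_add_one hu, sub_self]] at htel
  rw [← htel]
  refine Finset.sum_congr rfl fun x _ => ?_
  rw [edgeSign_overPoint_add_one, edgeSign_overPoint, edgeSign_underPoint_add_one,
    edgeSign_underPoint, D.arc_add_one (D.overPoint_notMem_range_underPoint x)]
  unfold overArc rightUnderArc leftUnderArc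
  split_ifs <;> ring

/-- The weights of a coboundary add up to zero. -/
theorem sum_sign_mul_coboundary_eq_zero {X : Type*} [Quandle X] (ρ : D.ProperColoring X)
    (f : X → ℤ) :
    ∑ x : D.Crossing, D.sign x * (2 * f (ρ.1 (D.overArc x)) - f (ρ.1 (D.rightUnderArc x))
      - f (Shelf.act (ρ.1 (D.overArc x)) (ρ.1 (D.rightUnderArc x)))) = 0 := by
  simpa only [ρ.2] using D.sum_sign_mul_arc_eq_zero fun α => f (ρ.1 α)

end OrientedKnotDiagram

/-! ### Colorings of a knot by a dihedral quandle -/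

namespace SignedGaussDiagram

variable (D : SignedGaussDiagram)

/-- The color of an arc, as an element of the ring `ZMod n`. -/
def dihedralColor {n : ℕ} (ρ : D.ProperColoring (Quandle.Dihedral n)) (α : D.Arc) : ZMod n := ρ.1 α

theorem dihedralColor_leftUnderArc {n : ℕ} (ρ : D.ProperColoring (Quandle.Dihedral n))
    (x : D.Crossing) : D.dihedralColor ρ (D.leftUnderArc x) =
      2 * D.dihedralColor ρ (D.overArc x) - D.dihedralColor ρ (D.rightUnderArc x) :=
  ρ.2 x

/-- The colors of a knot are congruent modulo every power of two.  (Modulo an odd `n` this says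
nothing.) -/
theorem two_pow_dvd_color_sub {n : ℕ} (ρ : D.ProperColoring (Quandle.Dihedral n)) (j : ℕ)
    (α β : D.Arc) : (2 : ZMod n) ^ j ∣ D.dihedralColor ρ α - D.dihedralColor ρ β := by
  induction j generalizing α β with
  | zero => simp
  | succ j ih =>
    have step : ∀ e : D.Edge, (2 : ZMod n) ^ (j + 1) ∣
        D.dihedralColor ρ (D.arc (e + 1)) - D.dihedralColor ρ (D.arc e) := by
      intro e
      by_cases hu : e ∈ Set.range D.underPoint
      · obtain ⟨x, rfl⟩ := hu
        have hdvd : (2 : ZMod n) ^ (j + 1) ∣ D.dihedralColor ρ (D.leftUnderArc x)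
            - D.dihedralColor ρ (D.rightUnderArc x) := by
          obtain ⟨y, hy⟩ := ih (D.overArc x) (D.rightUnderArc x)
          exact ⟨y, by rw [dihedralColor_leftUnderArc]; linear_combination 2 * hy⟩
        unfold leftUnderArc rightUnderArc at hdvd
        split_ifs at hdvd
        · exact hdvd
        · exact (dvd_sub_comm).mp hdvd
      · simp [D.arc_add_one hu]
    have nat : ∀ k : ℕ, (2 : ZMod n) ^ (j + 1) ∣
        D.dihedralColor ρ (D.arc (k : ZMod D.numPoints)) - D.dihedralColor ρ (D.arc 0) := by
      intro k
      induction k with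
      | zero => simp
      | succ k ihk => simpa using dvd_add (step k) ihk
    have all : ∀ α : D.Arc, (2 : ZMod n) ^ (j + 1) ∣
        D.dihedralColor ρ α - D.dihedralColor ρ (D.arc 0) := by
      rintro ⟨e⟩
      have h := nat (ZMod.val (n := D.numPoints) e)
      rw [ZMod.natCast_zmod_val] at h
      exact h
    simpa using dvd_sub (all α) (all β)

end SignedGaussDiagram

/-- In `ZMod (2 ^ k * m)` with `m` odd, doubling is injective on the multiples of `2 ^ k`. -/
theorem ZMod.eq_zero_of_two_mul_eq_zero_of_two_pow_dvd {n k m : ℕ} (hn : n = 2 ^ k * m)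
    (hm : Odd m) {z : ZMod n} (h2 : 2 * z = 0) (hz : (2 : ZMod n) ^ k ∣ z) : z = 0 := by
  have hmz : (m : ZMod n) * z = 0 := by
    obtain ⟨y, rfl⟩ := hz
    have h0 : ((2 ^ k * m : ℕ) : ZMod n) = 0 := by rw [← hn, ZMod.natCast_self]
    push_cast at h0
    linear_combination y * h0
  obtain ⟨r, rfl⟩ := hm
  push_cast at hmz
  linear_combination hmz - r * h2

open Classical in
/-- The residue class of `c₀` modulo `2 ^ k` in the dihedral quandle of order `n`. -/
noncomputable def cosetTwoPow (n k : ℕ) [NeZero n] (c₀ : ZMod n) : Finset (Quandle.Dihedral n) :=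
  (Finset.univ : Finset (ZMod n)).filter fun c : ZMod n => (2 : ZMod n) ^ k ∣ c - c₀

theorem mem_cosetTwoPow {n k : ℕ} [NeZero n] {c₀ c : ZMod n} :
    (show Quandle.Dihedral n from c) ∈ cosetTwoPow n k c₀ ↔ (2 : ZMod n) ^ k ∣ c - c₀ := by
  unfold cosetTwoPow
  exact Finset.mem_filter.trans (and_iff_right (Finset.mem_univ c))

theorem act_mem_cosetTwoPow {n k : ℕ} [NeZero n] {c₀ : ZMod n} :
    ∀ a ∈ cosetTwoPow n k c₀, ∀ b ∈ cosetTwoPow n k c₀, Shelf.act b a ∈ cosetTwoPow n k c₀ := by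
  intro (a : ZMod n) ha (b : ZMod n) hb
  obtain ⟨y, hy⟩ := mem_cosetTwoPow.mp ha
  obtain ⟨z, hz⟩ := mem_cosetTwoPow.mp hb
  refine (mem_cosetTwoPow (c := 2 * b - a)).mpr ⟨2 * z - y, ?_⟩
  linear_combination 2 * hz - hy

theorem injOn_act_cosetTwoPow {n k m : ℕ} [NeZero n] (hn : n = 2 ^ k * m) (hm : Odd m)
    {c₀ : ZMod n} (a : Quandle.Dihedral n) :
    Set.InjOn (fun b => Shelf.act b a) (cosetTwoPow n k c₀ : Set (Quandle.Dihedral n)) := by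
  intro (b : ZMod n) hb (c : ZMod n) hc h
  let a' : ZMod n := a
  have h' : 2 * b - a' = 2 * c - a' := h
  refine sub_eq_zero (a := b).mp (ZMod.eq_zero_of_two_mul_eq_zero_of_two_pow_dvd hn hm
    (by linear_combination h') ?_)
  simpa using dvd_sub (mem_cosetTwoPow.mp hb) (mem_cosetTwoPow.mp hc)

/-! ### Triviality of the invariant -/

theorem OrientedKnotDiagram.sum_weight_dihedral_eq_zero {n : ℕ} [NeZero n]
    {φ : Quandle.Dihedral n → Quandle.Dihedral n → ℤ} (hφ : IsPositiveQuandleTwoCocycle φ)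
    (D : OrientedKnotDiagram) (ρ : D.ProperColoring (Quandle.Dihedral n)) :
    ∑ x : D.Crossing, D.weight φ ρ x = 0 := by
  obtain ⟨k, m, hm, hn⟩ := Nat.exists_eq_two_pow_mul_odd (NeZero.ne n)
  let H := cosetTwoPow n k (D.dihedralColor ρ (D.arc 0))
  have hmem : ∀ α : D.Arc, ρ.1 α ∈ H := fun α =>
    mem_cosetTwoPow.mpr (D.two_pow_dvd_color_sub ρ k α (D.arc 0))
  have hcard : (H.card : ℤ) ≠ 0 :=
    Nat.cast_ne_zero.mpr (Finset.card_ne_zero_of_mem (hmem (D.arc 0)))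
  refine (mul_eq_zero.mp ?_).resolve_left hcard
  rw [Finset.mul_sum, ← D.sum_sign_mul_coboundary_eq_zero ρ fun a => -∑ b ∈ H, φ a b]
  refine Finset.sum_congr rfl fun x _ => ?_
  have h := hφ.card_nsmul_eq H act_mem_cosetTwoPow (fun a _ => injOn_act_cosetTwoPow hn hm a)
    (hmem (D.rightUnderArc x)) (hmem (D.overArc x))
  simp only [nsmul_eq_mul, Nat.cast_ofNat] at h
  rw [OrientedKnotDiagram.weight, smul_eq_mul]
  linear_combination D.sign x * h

/-- The invariant is trivial: it is the sum of `Col` copies of the identity of the group ring. -/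
theorem proposition5p2 (n : ℕ) [NeZero n]
    (φ : Quandle.Dihedral n → Quandle.Dihedral n → ℤ) (hφ : IsPositiveQuandleTwoCocycle φ)
    (D : OrientedKnotDiagram) :
    D.positiveCocycleInvariant φ =
      D.col (Quandle.Dihedral n) • (1 : AddMonoidAlgebra ℤ ℤ) := by
  unfold OrientedKnotDiagram.positiveCocycleInvariant SignedGaussDiagram.col
  simp only [D.sum_weight_dihedral_eq_zero hφ, Finset.sum_const, Finset.card_univ,
    Nat.card_eq_fintype_card, AddMonoidAlgebra.one_def]
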